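/- All matrices have integer entries. Two matrices $X,Y$ of the same order are amicable if $XY^\top=YX^\top$. Symmetric Williamson-type matrices of order $n$ are four symmetric, pairwise amicable $\pm1$ matrices $W_1,\dots,W_4$ of order $n$ with $\sum_{k}W_kW_k^\top=4nI_n$. Propus-type matrices of order $n$ are pairwise amicable $\pm1$ matrices $A,B,B,D$ of order $n$ with $A^\top=A$ and $AA^\top+2BB^\top+DD^\top=4nI_n$. A symmetric propus-type Hadamard matrix of order $4n$ is a symmetric Hadamard matrix of the form $$\begin{bmatrix}A&B&B&D\\B&D&-A&-B\\B&-A&-D&B\\D&-B&B&-A\end{bmatrix}$$ with $A,B,B,D$ propus-type matrices of order $n$. A symmetric conference matrix of order $m$ is a symmetric matrix $C$ with zero diagonal, off-diagonal entries $\pm1$ and $CC^\top=(m-1)I_m$; a matrix $Q$ of order $n$ is the core of a symmetric conference matrix if $\begin{bmatrix}0&e\\e^\top&Q\end{bmatrix}$ is a symmetric conference matrix of order $n+1$, where $e$ is the all-ones row. **Corollary.** Let $q\equiv1\pmod 4$ be a prime power such that $\tfrac12(q+1)$ is either a prime power or the order of the core of a symmetric conference matrix. Then there exist symmetric Williamson-type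 matrices of order $q+2$ and a symmetric propus-type Hadamard matrix of order $4(q+2)$. The second alternative occurs for $q=89$: there is a core of a symmetric conference matrix of order $45$. In particular, symmetric propus-type Hadamard matrices of orders $4\cdot 11$ and $4\cdot 83$ exist. -/

import Mathlib

open Matrix

namespace Propus

/-- All entries of the matrix are `1` or `-1`. -/
def IsSignMatrix {n : ℕ} (A : Matrix (Fin n) (Fin n) ℤ) : Prop :=
  ∀ i j, A i j = 1 ∨ A i j = -1

/-- Two matrices `X`, `Y` of the same order are amicable if `X Yᵀ = Y Xᵀ`. -/
def Amicable {n : ℕ} (X Y : Matrix (Fin n) (Fin n) ℤ) : Prop :=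
  X * Yᵀ = Y * Xᵀ

/-- Symmetric Williamson-type matrices of order `n`: four symmetric, pairwise amicable
`±1` matrices `W 0, W 1, W 2, W 3` of order `n` with `∑ W k (W k)ᵀ = 4 n I`. -/
structure IsSymmetricWilliamsonType {n : ℕ} (W : Fin 4 → Matrix (Fin n) (Fin n) ℤ) : Prop where
  sign : ∀ k, IsSignMatrix (W k)
  symm : ∀ k, (W k).IsSymm
  amicable : ∀ k l, k ≠ l → Amicable (W k) (W l)
  additive : ∑ k, W k * (W k)ᵀ = (4 * (n : ℤ)) • (1 : Matrix (Fin n) (Fin n) ℤ)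

/-- Propus-type matrices `A, B, B, D` of order `n`: pairwise amicable `±1` matrices with
`Aᵀ = A` and the additive property `A Aᵀ + 2 B Bᵀ + D Dᵀ = 4 n I`. -/
structure IsPropusType {n : ℕ} (A B D : Matrix (Fin n) (Fin n) ℤ) : Prop where
  sign_A : IsSignMatrix A
  sign_B : IsSignMatrix B
  sign_D : IsSignMatrix D
  symm_A : A.IsSymm
  amicable_AB : Amicable A B
  amicable_AD : Amicable A D
  amicable_BD : Amicable B D
  additive : A * Aᵀ + (2 : ℤ) • (B * Bᵀ) + D * Dᵀ
    = (4 * (n : ℤ)) • (1 : Matrix (Fin n) (Fin n) ℤ)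

/-- The propus array: the `4 × 4` block matrix below, as a matrix of order `4 n`. -/
def propusArray {n : ℕ} (A B D : Matrix (Fin n) (Fin n) ℤ) :
    Matrix (Fin (4 * n)) (Fin (4 * n)) ℤ :=
  reindex finProdFinEquiv finProdFinEquiv
    (Matrix.comp (Fin 4) (Fin 4) (Fin n) (Fin n) ℤ
      !![A,  B,  B,  D;
         B,  D, -A, -B;
         B, -A, -D,  B;
         D, -B,  B, -A])

/-- A symmetric propus-type Hadamard matrix of order `4 n`: a symmetric Hadamard matrix obtained
by plugging propus-type matrices of order `n` into the propus array. -/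
def IsSymmetricPropusTypeHadamard {n : ℕ} (H : Matrix (Fin (4 * n)) (Fin (4 * n)) ℤ) : Prop :=
  (∃ A B D : Matrix (Fin n) (Fin n) ℤ, IsPropusType A B D ∧ H = propusArray A B D) ∧
    H.IsSymm ∧ H.IsHadamard

/-- A symmetric conference matrix of order `m = |ι|`: a symmetric matrix with zero diagonal and
off-diagonal entries `±1` such that `C Cᵀ = (m - 1) I`. -/
structure IsSymmetricConference {ι : Type*} [Fintype ι] [DecidableEq ι]
    (C : Matrix ι ι ℤ) : Prop where
  diag : ∀ i, C i i = 0
  off_diag : ∀ i j, i ≠ j → C i j = 1 ∨ C i j = -1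
  symm : C.IsSymm
  mul_transpose : C * Cᵀ = ((Fintype.card ι : ℤ) - 1) • (1 : Matrix ι ι ℤ)

/-- `Q`, of order `n`, is the core of a symmetric conference matrix (of order `n + 1`): bordering
it by a row and a column of ones, with corner entry `0`, gives a symmetric conference matrix. -/
def IsSymmetricConferenceCore {n : ℕ} (Q : Matrix (Fin n) (Fin n) ℤ) : Prop :=
  IsSymmetricConference
    (fromBlocks (0 : Matrix Unit Unit ℤ) (of fun _ _ => 1) (of fun _ _ => 1) Q)

end Propus

/-! Put n = (q+1)/2, which is odd. It is enough to find symmetric commuting sign matrices X, Y, Z of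
order 2n+1 = q+2 with X² + 2Y² + Z² = 4(2n+1)I: the quadruple X, Y, Y, Z is then both
Williamson-type and propus-type, and the propus array is symmetric (`exists_williamson_and_propus`).

A pair U, V with complementary supports gives the sign matrix U⊗[[1,1],[1,1]] + V⊗[[1,-1],[-1,1]].
The two 2×2 factors annihilate each other, so products treat U and V separately, and a constant
border sees only the row sums of U (`bordered_mul`). The pairs are (I, A), (P, R), (0, B), where: A,
B are developed over a cyclic group G of order n, with A² + B² = qI, and come from the quadratic
character on the field of q² elements (`exists_complementary_pair`); P satisfies P² = nI - J and PJ
= 0, with zeros exactly at the ones of a symmetric involutory permutation matrix R commuting with A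
and B. P meets only I and 0 in the U-slot, so it need not commute with A or B.

If a conference core of order n exists, it serves as P, with R = I. If n is a prime power, P is
χ(x+y) on the field of n elements, which is symmetric even for n ≡ 3 mod 4; its zeros lie on y = -x,
so R must be the inversion of G. The field is relabelled by G so that negation becomes inversion; no
homomorphism is needed (`exists_equiv_semiconj`).

The core of order 45 is Mathon's, verified by finite computation. -/

namespace Propus

/-! ### Bordered matrices and the commuting quadruple -/

section Bordered

variable {ι : Type*}

/-- The matrix `[[U + V, U - V], [U - V, U + V]]`, bordered by a row and a column with constant
entry `s` and corner entry `1`. -/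
def bordered (s : ℤ) (U V : Matrix ι ι ℤ) : Matrix (Unit ⊕ (ι ⊕ ι)) (Unit ⊕ (ι ⊕ ι)) ℤ :=
  fromBlocks 1 (of fun _ _ => s) (of fun _ _ => s) (fromBlocks (U + V) (U - V) (U - V) (U + V))

theorem bordered_isSymm (s : ℤ) {U V : Matrix ι ι ℤ} (hU : U.IsSymm) (hV : V.IsSymm) :
    (bordered s U V).IsSymm := by
  unfold bordered IsSymm
  simp only [fromBlocks_transpose, transpose_add, transpose_sub, hU.eq, hV.eq, transpose_one]
  rfl

theorem bordered_sign {s : ℤ} (hs : s = 1 ∨ s = -1) {U V : Matrix ι ι ℤ}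
    (h : ∀ i j, (U i j = 0 ∧ (V i j = 1 ∨ V i j = -1)) ∨ (V i j = 0 ∧ (U i j = 1 ∨ U i j = -1))) :
    ∀ i j, bordered s U V i j = 1 ∨ bordered s U V i j = -1 := by
  rintro (i | i | i) (j | j | j)
  · left; rfl
  · exact hs
  · exact hs
  · exact hs
  · rcases h i j with ⟨h1, h2 | h2⟩ | ⟨h1, h2 | h2⟩ <;> simp [bordered, h1, h2]
  · rcases h i j with ⟨h1, h2 | h2⟩ | ⟨h1, h2 | h2⟩ <;> simp [bordered, h1, h2]
  · exact hs
  · rcases h i j with ⟨h1, h2 | h2⟩ | ⟨h1, h2 | h2⟩ <;> simp [bordered, h1, h2]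
  · rcases h i j with ⟨h1, h2 | h2⟩ | ⟨h1, h2 | h2⟩ <;> simp [bordered, h1, h2]

variable [Fintype ι]

/-- The factors [[1,1],[1,1]] and [[1,-1],[-1,1]] square to twice themselves and have product zero,
so no mixed products U V' or V U' survive. The second factor has zero row sums, so V never reaches
the border. -/
theorem bordered_mul (s t r r' : ℤ) (U V U' V' : Matrix ι ι ℤ) (hU : ∀ i, ∑ j, U i j = r)
    (hU' : ∀ j, ∑ i, U' i j = r') :
    bordered s U V * bordered t U' V' =
      fromBlocks (of fun _ _ => 1 + 2 * (Fintype.card ι : ℤ) * (s * t))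
        (of fun _ _ => t + 2 * (s * r')) (of fun _ _ => s + 2 * (r * t))
        (fromBlocks
          ((of fun _ _ => s * t) + (2 : ℤ) • (U * U') + (2 : ℤ) • (V * V'))
          ((of fun _ _ => s * t) + (2 : ℤ) • (U * U') - (2 : ℤ) • (V * V'))
          ((of fun _ _ => s * t) + (2 : ℤ) • (U * U') - (2 : ℤ) • (V * V'))
          ((of fun _ _ => s * t) + (2 : ℤ) • (U * U') + (2 : ℤ) • (V * V'))) := by
  have e1 : (U + V) * (U' + V') + (U - V) * (U' - V') = (2 : ℤ) • (U * U') + (2 : ℤ) • (V * V') := by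
    noncomm_ring
  have e2 : (U + V) * (U' - V') + (U - V) * (U' + V') = (2 : ℤ) • (U * U') - (2 : ℤ) • (V * V') := by
    noncomm_ring
  have e3 : (U - V) * (U' + V') + (U + V) * (U' - V') = (2 : ℤ) • (U * U') - (2 : ℤ) • (V * V') := by
    noncomm_ring
  have e4 : (U - V) * (U' - V') + (U + V) * (U' + V') = (2 : ℤ) • (U * U') + (2 : ℤ) • (V * V') := by
    noncomm_ring
  unfold bordered
  rw [fromBlocks_multiply, fromBlocks_multiply, e1, e2, e3, e4]
  congr 1
  · ext i j
    simp only [Matrix.add_apply, Matrix.mul_apply, of_apply, Finset.sum_const, Finset.card_univ,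
      Fintype.card_sum, Fintype.card_unit, Matrix.one_apply_eq, nsmul_eq_mul]
    push_cast
    ring
  · ext i (j | j) <;>
    · simp [Matrix.mul_apply, Fintype.sum_sum_type, ← Finset.mul_sum, Finset.sum_add_distrib, hU']
      ring
  · ext (i | i) j <;>
    · simp [Matrix.mul_apply, Fintype.sum_sum_type, ← Finset.sum_mul, Finset.sum_add_distrib, hU]
      ring
  · ext (i | i) (j | j) <;>
    · simp [Matrix.mul_apply]
      ring

theorem bordered_commute {s t r r' : ℤ} {U V U' V' : Matrix ι ι ℤ}
    (hUr : ∀ i, ∑ j, U i j = r) (hUc : ∀ j, ∑ i, U i j = r)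
    (hUr' : ∀ i, ∑ j, U' i j = r') (hUc' : ∀ j, ∑ i, U' i j = r')
    (hU : Commute U U') (hV : Commute V V') (h : t + 2 * (s * r') = s + 2 * (t * r)) :
    Commute (bordered s U V) (bordered t U' V') := by
  unfold Commute SemiconjBy
  rw [bordered_mul s t r r' _ _ _ _ hUr hUc', bordered_mul t s r' r _ _ _ _ hUr' hUc, hU.eq, hV.eq,
    mul_comm r t, mul_comm r' s, h, mul_comm s t]

variable [DecidableEq ι]

/-- Four symmetric commuting sign matrices of order `2 |ι| + 1`, two of which coincide. -/
theorem exists_symm_commuting_quadruple {A B P R : Matrix ι ι ℤ}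
    (hAs : A.IsSymm) (hBs : B.IsSymm) (hPs : P.IsSymm) (hRs : R.IsSymm)
    (hA0 : ∀ i, A i i = 0) (hA : ∀ i j, i ≠ j → A i j = 1 ∨ A i j = -1)
    (hB : ∀ i j, B i j = 1 ∨ B i j = -1)
    (hPR : ∀ i j, (P i j = 0 ∧ R i j = 1) ∨ (R i j = 0 ∧ (P i j = 1 ∨ P i j = -1)))
    (hAB : Commute A B) (hRA : Commute R A) (hRB : Commute R B)
    (hAB2 : A * A + B * B = (2 * (Fintype.card ι : ℤ) - 1) • (1 : Matrix ι ι ℤ))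
    (hR : R * R = 1) (hP : P * P = (Fintype.card ι : ℤ) • (1 : Matrix ι ι ℤ) - of fun _ _ => 1)
    (hP1 : ∀ i, ∑ j, P i j = 0) :
    ∃ X Y Z : Matrix (Unit ⊕ (ι ⊕ ι)) (Unit ⊕ (ι ⊕ ι)) ℤ,
      X.IsSymm ∧ Y.IsSymm ∧ Z.IsSymm ∧
      (∀ i j, X i j = 1 ∨ X i j = -1) ∧ (∀ i j, Y i j = 1 ∨ Y i j = -1) ∧
      (∀ i j, Z i j = 1 ∨ Z i j = -1) ∧ Commute X Y ∧ Commute X Z ∧ Commute Y Z ∧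
      X * X + (2 : ℤ) • (Y * Y) + Z * Z = (4 * (2 * (Fintype.card ι : ℤ) + 1)) • 1 := by
  have hI : ∀ i, ∑ j, (1 : Matrix ι ι ℤ) i j = 1 := by simp [Matrix.one_apply]
  have hI' : ∀ j, ∑ i, (1 : Matrix ι ι ℤ) i j = 1 := by simp [Matrix.one_apply]
  have h0 : ∀ i, ∑ j, (0 : Matrix ι ι ℤ) i j = 0 := by simp
  have h0' : ∀ j, ∑ i, (0 : Matrix ι ι ℤ) i j = 0 := by simp
  have hP1' : ∀ j, ∑ i, P i j = 0 := fun j => by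
    rw [← hP1 j]; exact Finset.sum_congr rfl fun i _ => hPs.apply j i
  -- The row sums of 1, P, 0 are 1, 0, 0. The border -1 on the first matrix makes its border
  -- products with the other two agree in both orders: 1 = -1 + 2·1.
  refine ⟨bordered (-1) 1 A, bordered 1 P R, bordered 1 0 B, bordered_isSymm _ isSymm_one hAs,
    bordered_isSymm _ hPs hRs, bordered_isSymm _ isSymm_zero hBs, bordered_sign (.inr rfl) ?_,
    bordered_sign (.inl rfl) ?_, bordered_sign (.inl rfl) ?_,
    bordered_commute hI hI' hP1 hP1' (Commute.one_left _) hRA.symm (by norm_num),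
    bordered_commute hI hI' h0 h0' (Commute.one_left _) hAB (by norm_num),
    bordered_commute hP1 hP1' h0 h0' (Commute.zero_right _) hRB (by norm_num), ?_⟩
  · intro i j
    by_cases h : i = j
    · subst h; right; simp [hA0]
    · left; simpa [h] using hA i j h
  · intro i j
    rcases hPR i j with h | h
    · exact .inl ⟨h.1, .inl h.2⟩
    · exact .inr h
  · exact fun i j => .inl ⟨rfl, hB i j⟩
  -- With n = |ι|, the border entries add up to -3 + 2·1 + 1 = 0. In the blocks the 4J from the
  -- borders cancels the -4J in 4P². The coefficients of I are 2 + 2(2n-1) + 4n + 4 = 8n + 4 in the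
  -- diagonal blocks and 2 - 2(2n-1) + 4n - 4 = 0 in the others.
  · rw [bordered_mul _ _ _ _ _ _ _ _ hI hI', bordered_mul _ _ _ _ _ _ _ _ hP1 hP1',
      bordered_mul _ _ _ _ _ _ _ _ h0 h0', hR, hP, eq_sub_of_add_eq hAB2]
    ext (i | i | i) (j | j | j) <;>
      simp only [Matrix.add_apply, Matrix.sub_apply, Matrix.smul_apply,
        fromBlocks_apply₁₁, fromBlocks_apply₁₂, fromBlocks_apply₂₁, fromBlocks_apply₂₂, of_apply, Matrix.one_apply, mul_zero, mul_one,
        smul_eq_mul, Matrix.zero_apply, Sum.inr.injEq, Sum.inl.injEq, reduceCtorEq,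
        if_false, if_true] <;>
      ring

end Bordered

/-! ### The propus array -/

theorem propusArray_isSymm {n : ℕ} {A B D : Matrix (Fin n) (Fin n) ℤ} (hA : A.IsSymm)
    (hB : B.IsSymm) (hD : D.IsSymm) : (propusArray A B D).IsSymm := by
  unfold propusArray
  rw [reindex_apply]
  refine IsSymm.submatrix ?_ _
  ext ⟨i, k⟩ ⟨j, l⟩
  have hA' : A l k = A k l := hA.apply k l
  have hB' : B l k = B k l := hB.apply k l
  have hD' : D l k = D k l := hD.apply k l
  fin_cases i <;> fin_cases j <;>
    simp only [transpose_apply, comp_apply, of_apply, cons_val, Fin.zero_eta, Fin.mk_one,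
      Fin.reduceFinMk, Matrix.neg_apply, hA', hB', hD']

/-- In the square of the array every off-diagonal block is a signed sum of commutators of A, B, D,
up to cancelling squares, and every diagonal block is the additive expression. -/
theorem propusArray_mul_self {n : ℕ} {A B D : Matrix (Fin n) (Fin n) ℤ}
    (hAB : Commute A B) (hAD : Commute A D) (hBD : Commute B D)
    (h : A * A + (2 : ℤ) • (B * B) + D * D = (4 * (n : ℤ)) • (1 : Matrix (Fin n) (Fin n) ℤ)) :
    propusArray A B D * propusArray A B D = (4 * (n : ℤ)) • 1 := by
  unfold propusArray
  have key : !![A,  B,  B,  D; B,  D, -A, -B; B, -A, -D,  B; D, -B,  B, -A] *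
      !![A,  B,  B,  D; B,  D, -A, -B; B, -A, -D,  B; D, -B,  B, -A] =
      diagonal fun _ : Fin 4 => (4 * (n : ℤ)) • (1 : Matrix (Fin n) (Fin n) ℤ) := by
    have h1 := hAB.eq
    have h2 := hAD.eq
    have h3 := hBD.eq
    rw [← h]
    ext1 i j
    fin_cases i <;> fin_cases j <;>
      simp only [Matrix.mul_apply, Fin.sum_univ_four, of_apply, cons_val, Fin.zero_eta, Fin.mk_one,
        Fin.reduceFinMk, mul_neg, neg_mul, neg_neg, h1, h2, h3, diagonal_apply_eq, two_smul, ne_eq,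
        Fin.reduceEq, not_false_eq_true, diagonal_apply_ne, zero_ne_one, one_ne_zero] <;>
      abel
  rw [reindex_apply, submatrix_mul_equiv, ← compRingEquiv_apply, ← map_mul, key,
    compRingEquiv_apply, ← submatrix_one_equiv finProdFinEquiv.symm]
  change _ = ((4 * (n : ℤ)) • (1 : Matrix (Fin 4 × Fin n) (Fin 4 × Fin n) ℤ)).submatrix _ _
  congr 1
  ext ⟨i, k⟩ ⟨j, l⟩
  by_cases hij : i = j <;> 
    simp only [comp_apply, diagonal_apply, Matrix.smul_apply, Matrix.one_apply, Prod.mk.injEq, hij,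
      true_and, false_and, if_true, if_false, Matrix.zero_apply, smul_zero]

theorem isSymmetricPropusTypeHadamard_propusArray {n : ℕ} {A B D : Matrix (Fin n) (Fin n) ℤ}
    (hA : A.IsSymm) (hB : B.IsSymm) (hD : D.IsSymm) (h : IsPropusType A B D) :
    IsSymmetricPropusTypeHadamard (propusArray A B D) := by
  refine ⟨⟨A, B, D, h, rfl⟩, propusArray_isSymm hA hB hD, ?_⟩
  have hsq := propusArray_mul_self (A := A) (B := B) (D := D)
    (by simpa only [Amicable, hA.eq, hB.eq, commute_iff_eq] using h.amicable_AB)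
    (by simpa only [Amicable, hA.eq, hD.eq, commute_iff_eq] using h.amicable_AD)
    (by simpa only [Amicable, hB.eq, hD.eq, commute_iff_eq] using h.amicable_BD)
    (by simpa only [hA.eq, hB.eq, hD.eq] using h.additive)
  have hsymm := (propusArray_isSymm hA hB hD).eq
  have hT : (propusArray A B D)ᴴ = propusArray A B D := by
    rw [conjTranspose_eq_transpose_of_trivial, hsymm]
  refine ⟨fun i j => ?_, by rw [hT, hsq]; simp, by rw [hT, hsq]; simp⟩
  have hs : propusArray A B D i j = 1 ∨ propusArray A B D i j = -1 := by
    unfold propusArray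
    rw [reindex_apply, submatrix_apply]
    generalize finProdFinEquiv.symm i = x
    generalize finProdFinEquiv.symm j = y
    obtain ⟨i, k⟩ := x
    obtain ⟨j, l⟩ := y
    have hA' := h.sign_A k l
    have hB' := h.sign_B k l
    have hD' := h.sign_D k l
    have neg_sign : ∀ {x : ℤ}, x = 1 ∨ x = -1 → -x = 1 ∨ -x = -1 := by rintro x (rfl | rfl) <;> simp
    have hA'' := neg_sign hA'
    have hB'' := neg_sign hB'
    have hD'' := neg_sign hD'
    fin_cases i <;> fin_cases j <;>
      simp only [comp_apply, of_apply, cons_val, Fin.zero_eta, Fin.mk_one, Fin.reduceFinMk,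
        Matrix.neg_apply] <;>
      assumption
  rcases hs with hs | hs <;> simp [hs, Unitary.mem_iff]

/-! ### A complementary pair from the quadratic extension of a finite field -/

section TwoCirculant

open QuadraticAlgebra

variable {F : Type*} [Field F] [Fintype F]

/-- The two linear forms in z are independent, with determinant the imaginary part in `h`, so they
are coordinates on the extension and the sum factors into two complete character sums. -/
theorem sum_quadraticChar_mul_bilinear [DecidableEq F] (hF : ringChar F ≠ 2) (d : F)
    {x y : QuadraticAlgebra F d 0} [Fintype (QuadraticAlgebra F d 0)] (h : (star x * y).im ≠ 0) :
    ∑ z : QuadraticAlgebra F d 0, quadraticChar F (star x * z).im * quadraticChar F (star y * z).im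
      = 0 := by
  let f : QuadraticAlgebra F d 0 → F × F := fun z => ((star x * z).im, (star y * z).im)
  have hf : Function.Injective f := by
    intro z w hzw
    simp only [f, Prod.mk.injEq, im_mul, re_star, im_star, zero_mul, add_zero] at hzw h
    obtain ⟨h1, h2⟩ := hzw
    ext
    · refine mul_left_cancel₀ h ?_
      linear_combination y.re * h1 - x.re * h2
    · refine mul_left_cancel₀ h ?_
      linear_combination y.im * h1 - x.im * h2
  have hb : Function.Bijective f := by
    rw [Fintype.bijective_iff_injective_and_card]
    exact ⟨hf, Fintype.card_congr (equivProd d 0)⟩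
  rw [hb.sum_comp (fun u : F × F => quadraticChar F u.1 * quadraticChar F u.2),
    Fintype.sum_prod_type]
  simp_rw [← Finset.mul_sum, quadraticChar_sum_zero hF, mul_zero, Finset.sum_const_zero]

/-- Frobenius fixes F and sends ω = √d to d^((q-1)/2) ω = -ω by Euler's criterion, so it is
conjugation. -/
theorem star_eq_pow_card (hF : ringChar F ≠ 2) {d : F} (hd : ¬ IsSquare d)
    (z : QuadraticAlgebra F d 0) : star z = z ^ Fintype.card F := by
  have hodd := FiniteField.odd_card_of_char_ne_two hF
  have hd0 : d ≠ 0 := by rintro rfl; exact hd (IsSquare.zero)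
  have hpow : d ^ (Fintype.card F / 2) = -1 :=
    (FiniteField.pow_dichotomy hF hd0).resolve_left fun h =>
      hd ((FiniteField.isSquare_iff hF hd0).2 h)
  have hω : (omega : QuadraticAlgebra F d 0) ^ Fintype.card F = - omega := by
    obtain ⟨m, hm⟩ := Nat.odd_iff.2 hodd
    rw [show Fintype.card F / 2 = m by omega] at hpow
    rw [hm, pow_succ, pow_mul, sq, omega_mul_omega_eq_algebraMap,
      map_zero, zero_mul, add_zero, ← map_pow, hpow, map_neg, map_one, neg_one_mul]
  have hz : z = algebraMap F _ z.re + z.im • omega := by ext <;> simp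
  have hfrob := map_add (FiniteField.frobeniusAlgHom F (QuadraticAlgebra F d 0))
    (algebraMap F _ z.re) (z.im • omega)
  rw [← hz, map_smul, AlgHom.commutes, FiniteField.coe_frobeniusAlgHom] at hfrob
  simp only [hω] at hfrob
  rw [hfrob]
  ext <;> simp

theorem exists_subgroup_card_eq {K : Type*} [Field K] [Finite K] {n : ℕ}
    (h : n ∣ Nat.card Kˣ) : ∃ G : Subgroup Kˣ, Nat.card G = n := by
  obtain ⟨u, hu⟩ := IsCyclic.exists_generator (α := Kˣ)
  obtain ⟨m, hm⟩ := h
  have hu' : orderOf u = n * m := by rw [← hm, orderOf_eq_card_of_forall_mem_zpowers hu]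
  have hpos : 0 < n * m := hu' ▸ orderOf_pos u
  refine ⟨Subgroup.zpowers (u ^ m), ?_⟩
  rw [Nat.card_zpowers, orderOf_pow_of_dvd (Nat.pos_of_mul_pos_left hpos).ne'
    (hu' ▸ dvd_mul_left _ _),
    hu', Nat.mul_div_cancel _ (Nat.pos_of_mul_pos_left hpos)]

/-- A pair of `±1` functions (up to a zero at the identity) on an abelian group of order
`(q + 1) / 2`, coming from the symmetric conference matrix of order `q + 1`. -/
theorem exists_complementary_pair {F : Type} [Field F] [Fintype F] [DecidableEq F]
    (hF : Fintype.card F % 4 = 1) :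
    ∃ (G : Type) (_ : CommGroup G) (_ : Fintype G) (a b : G → ℤ),
      2 * Fintype.card G = Fintype.card F + 1 ∧
      a 1 = 0 ∧ (∀ g, g ≠ 1 → a g = 1 ∨ a g = -1) ∧ (∀ g, b g = 1 ∨ b g = -1) ∧
      (∀ g, a g⁻¹ = a g) ∧ (∀ g, b g⁻¹ = b g) ∧
      ∀ k, k ≠ 1 → ∑ g, (a g * a (k⁻¹ * g) + b g * b (k⁻¹ * g)) = 0 := by
  have hF2 : ringChar F ≠ 2 := fun h => by
    have := FiniteField.even_card_of_char_two h
    omega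
  obtain ⟨d, hd⟩ := FiniteField.exists_nonsquare hF2
  have hfact : Fact (∀ r, r ^ 2 ≠ d + 0 * r) := ⟨fun r hr => hd ⟨r, by rw [← sq, hr]; ring⟩⟩
  -- Here q ≡ 1 mod 4 enters: χ is even, which later makes a(g) = χ(im g) invariant under g ↦ g⁻¹.
  obtain ⟨i, hi⟩ : IsSquare (-1 : F) := FiniteField.isSquare_neg_one_iff.2 (by omega)
  have hχ : ∀ x : F, quadraticChar F (-x) = quadraticChar F x := fun x => by
    have hi0 : i ≠ 0 := by rintro rfl; simp at hi
    rw [← neg_one_mul, map_mul, hi, ← sq, quadraticChar_sq_one' hi0, one_mul]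
  obtain ⟨n, hn⟩ : ∃ n, n = (Fintype.card F + 1) / 2 := ⟨_, rfl⟩
  have hn2 : 2 * n = Fintype.card F + 1 := by omega
  have hodd : Odd n := by rw [Nat.odd_iff]; omega
  let _ : Fintype (QuadraticAlgebra F d 0) := Fintype.ofEquiv _ (equivProd d 0).symm
  have hK : Fintype.card (QuadraticAlgebra F d 0) = Fintype.card F ^ 2 := by
    rw [Fintype.card_congr (equivProd d 0), Fintype.card_prod, sq]
  classical
  obtain ⟨q', hq'⟩ : ∃ q', Fintype.card F = q' + 1 := ⟨Fintype.card F - 1, by omega⟩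
  have hKu : Fintype.card (QuadraticAlgebra F d 0)ˣ = q' * (2 * n) := by
    rw [Fintype.card_units, hK, hn2, hq']
    have : (q' + 1) ^ 2 = q' * (q' + 1 + 1) + 1 := by ring
    omega
  -- G is the index-two subgroup of the norm-one group, which has order q + 1 = 2n. As n is odd, G
  -- omits -1; hence no element is purely imaginary and only 1 has imaginary part zero.
  obtain ⟨G, hG⟩ := exists_subgroup_card_eq (K := QuadraticAlgebra F d 0) (n := n)
    (by rw [Nat.card_eq_fintype_card, hKu]; exact ⟨q' * 2, by ring⟩)
  have hGn : ∀ g ∈ G, (g : QuadraticAlgebra F d 0) ^ n = 1 := fun g hg => by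
    have := pow_card_eq_one' (x := (⟨g, hg⟩ : G))
    rw [hG] at this
    simpa using congrArg (fun x : G => x.1.1) this
  have hcardG : Fintype.card G = n := by rw [← hG, Nat.card_eq_fintype_card]
  have hstar : ∀ g ∈ G, star (g : QuadraticAlgebra F d 0) * g = 1 := fun g hg => by
    rw [star_eq_pow_card hF2 hd, ← pow_succ, ← hn2, mul_comm, pow_mul, hGn g hg, one_pow]
  have hinv : ∀ g ∈ G, ((g⁻¹ : (QuadraticAlgebra F d 0)ˣ) : QuadraticAlgebra F d 0) =
      star (g : QuadraticAlgebra F d 0) := fun g hg =>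
    (Units.eq_inv_of_mul_eq_one_right (hstar g hg)).symm
  have hnorm : ∀ g ∈ G, QuadraticAlgebra.norm (g : QuadraticAlgebra F d 0) = 1 := fun g hg => by
    have h := hstar g hg
    rw [mul_comm, ← algebraMap_norm_eq_mul_star] at h
    exact algebraMap_injective (by rw [h, map_one])
  have hre : ∀ g ∈ G, (g : QuadraticAlgebra F d 0).re ≠ 0 := fun g hg h => by
    have h1 : star (g : QuadraticAlgebra F d 0) = -g := by ext <;> simp [h]
    have h2 : (star (g : QuadraticAlgebra F d 0)) ^ n = 1 := by rw [← star_pow, hGn g hg, star_one]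
    rw [h1, hodd.neg_pow, hGn g hg] at h2
    exact Ring.neg_one_ne_one_of_char_ne_two hF2 (by simpa using congrArg re h2)
  have him : ∀ g ∈ G, (g : QuadraticAlgebra F d 0).im = 0 → g = 1 := fun g hg h => by
    have h1 : star (g : QuadraticAlgebra F d 0) = g := by ext <;> simp [h]
    have h2 := hstar g hg
    rw [h1, ← sq] at h2
    have h3 := hGn g hg
    obtain ⟨m, hm⟩ := hodd
    rw [hm, pow_succ, pow_mul, h2, one_pow, one_mul] at h3
    exact Units.ext h3
  refine ⟨G, inferInstance, inferInstance, fun g => quadraticChar F g.1.1.im,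
    fun g => quadraticChar F g.1.1.re, by rw [hcardG, hn2],
    by simp, fun g hg => ?_, fun g => ?_, fun g => ?_, fun g => ?_, fun k hk => ?_⟩
  · exact quadraticChar_dichotomy fun h => hg (Subtype.ext (him g g.2 h))
  · exact quadraticChar_dichotomy (hre g g.2)
  · simp only [InvMemClass.coe_inv, hinv g g.2, im_star, hχ]
  · simp only [InvMemClass.coe_inv, hinv g g.2, re_star, zero_mul, add_zero]
  -- T sums to zero over the whole extension and is invariant under scaling by Fˣ; the correlation
  -- is read off by splitting the sum into Fˣ-orbits.
  · let T : QuadraticAlgebra F d 0 → ℤ := fun z =>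
      quadraticChar F (star (1 : QuadraticAlgebra F d 0) * z).im * quadraticChar F (star k.1.1 * z).im
    have hT : ∑ z, T z = 0 := sum_quadraticChar_mul_bilinear hF2 d fun h => hk
      (Subtype.ext (him k k.2 (by simpa using h)))
    have hTs : ∀ (c : Fˣ) z, T ((c : F) • z) = T z := fun c z => by
      have : quadraticChar F (c : F) ^ 2 = 1 := quadraticChar_sq_one c.ne_zero
      simp only [T, mul_smul_comm, im_smul, smul_eq_mul, map_mul]
      linear_combination (quadraticChar F (star (1 : QuadraticAlgebra F d 0) * z).im *
        quadraticChar F (star k.1.1 * z).im) * this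
    -- The nonzero elements are the disjoint union of Fˣ·G and Fˣ·ωG. Norms separate the two parts,
    -- since N(ω) = -d is a nonsquare, and the counts match: (q-1)·2n = q² - 1. On ωG imaginary
    -- parts become real parts, which produces the b-terms.
    let f : Fˣ × (G ⊕ G) → QuadraticAlgebra F d 0 := fun p =>
      (p.1 : F) • Sum.elim (fun g : G => g.1.1) (fun g : G => omega * g.1.1) p.2
    have hns : ∀ (c : F) (z : QuadraticAlgebra F d 0), QuadraticAlgebra.norm (c • z) =
        c ^ 2 * QuadraticAlgebra.norm z := fun c z => by
      simp only [QuadraticAlgebra.norm_def, re_smul, im_smul, smul_eq_mul]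
      ring
    have hnω : QuadraticAlgebra.norm (omega : QuadraticAlgebra F d 0) = -d := by
      simp [QuadraticAlgebra.norm_def]
    have hcancel : ∀ (c c' : Fˣ) (g g' : G), (c : F) • g.1.1 = (c' : F) • g'.1.1 →
        c = c' ∧ g = g' := by
      intro c c' g g' h
      have hsq : (c : F) ^ 2 = (c' : F) ^ 2 := by
        simpa only [hns, hnorm g g.2, hnorm g' g'.2, mul_one] using congrArg QuadraticAlgebra.norm h
      rcases sq_eq_sq_iff_eq_or_eq_neg.1 hsq with hc | hc
      · rw [hc] at h
        exact ⟨Units.ext hc, Subtype.ext (Units.ext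
          (smul_right_injective (QuadraticAlgebra F d 0) c'.ne_zero h))⟩
      · rw [hc, neg_smul, ← smul_neg] at h
        have h1 := congrArg (· ^ n) (smul_right_injective (QuadraticAlgebra F d 0) c'.ne_zero h)
        simp only [hodd.neg_pow, hGn g g.2, hGn g' g'.2] at h1
        exact (Ring.neg_one_ne_one_of_char_ne_two hF2 (by simpa using congrArg re h1)).elim
    have hcross : ∀ (c c' : Fˣ) (g g' : G),
        (c : F) • g.1.1 ≠ (c' : F) • (omega * g'.1.1) := by
      intro c c' g g' h
      have hsq : (c : F) ^ 2 = (c' : F) ^ 2 * -d := by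
        simpa only [hns, map_mul, hnorm g g.2, hnorm g' g'.2, mul_one, hnω]
          using congrArg QuadraticAlgebra.norm h
      refine hd ⟨i * (c / c'), ?_⟩
      have := c'.ne_zero
      field_simp
      linear_combination hsq + (c : F) ^ 2 * hi
    have hω0 : (omega : QuadraticAlgebra F d 0) ≠ 0 := fun h => by simpa using congrArg im h
    have hf : Function.Injective f := by
      rintro ⟨c, g | g⟩ ⟨c', g' | g'⟩ h
      · obtain ⟨rfl, rfl⟩ := hcancel c c' g g' h
        rfl
      · exact (hcross c c' g g' h).elim
      · exact (hcross c' c g' g h.symm).elim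
      · simp only [f, Sum.elim_inr, ← mul_smul_comm] at h
        obtain ⟨rfl, rfl⟩ := hcancel c c' g g' (mul_left_cancel₀ hω0 h)
        rfl
    have himg : Finset.univ.image f = Finset.univ.erase (0 : QuadraticAlgebra F d 0) := by
      refine Finset.eq_of_subset_of_card_le ?_ ?_
      · intro z hz
        obtain ⟨⟨c, g | g⟩, -, rfl⟩ := Finset.mem_image.1 hz <;> simp [f, hω0]
      · rw [Finset.card_image_of_injective _ hf, Finset.card_erase_of_mem (Finset.mem_univ _),
          Finset.card_univ, Finset.card_univ, ← Fintype.card_units, hKu, Fintype.card_prod,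
          Fintype.card_sum, hcardG, Fintype.card_units, hq', two_mul, Nat.add_sub_cancel]
    have hsum : ∑ p, T (f p) = 0 := by
      rw [← Finset.sum_image (f := T) hf.injOn, himg, Finset.sum_erase _ (by simp [T]), hT]
    rw [Fintype.sum_prod_type] at hsum
    simp only [f, hTs, Finset.sum_const, Fintype.sum_sum_type, Sum.elim_inl, Sum.elim_inr] at hsum
    have hsum' := (smul_eq_zero.1 hsum).resolve_left (by simp)
    rw [← Finset.sum_add_distrib] at hsum'
    rw [← hsum']
    refine Finset.sum_congr rfl fun g _ => ?_
    simp only [T, star_one, one_mul, Subgroup.coe_mul, InvMemClass.coe_inv, Units.val_mul,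
      hinv k k.2]
    congr 2
    · simp
    · simp [mul_assoc, mul_left_comm]

end TwoCirculant

/-! ### Properties of cores, and conjugacy of involutions -/

theorem IsSymmetricConferenceCore.properties {n : ℕ} {Q : Matrix (Fin n) (Fin n) ℤ}
    (h : IsSymmetricConferenceCore Q) :
    Q.IsSymm ∧ (∀ i, Q i i = 0) ∧ (∀ i j, i ≠ j → Q i j = 1 ∨ Q i j = -1) ∧
      (∀ i, ∑ j, Q i j = 0) ∧
      Q * Q = (n : ℤ) • (1 : Matrix (Fin n) (Fin n) ℤ) - of fun _ _ => 1 := by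
  have hs : Q.IsSymm := by
    ext i j
    exact h.symm.apply (Sum.inr i) (Sum.inr j)
  have hm := h.mul_transpose
  rw [fromBlocks_transpose, hs.eq, fromBlocks_multiply] at hm
  refine ⟨hs, fun i => h.diag (Sum.inr i), fun i j hij =>
    h.off_diag (Sum.inr i) (Sum.inr j) (by simpa using hij), fun i => ?_, ?_⟩
  · have := congrFun (congrFun hm (Sum.inr i)) (Sum.inl ())
    simpa [Matrix.mul_apply] using this
  · ext i j
    have := congrFun (congrFun hm (Sum.inr i)) (Sum.inr j)
    simp only [fromBlocks_apply₂₂, Matrix.add_apply, Matrix.smul_apply, Matrix.one_apply,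
      Sum.inr.injEq, Fintype.card_sum, Fintype.card_unit, Fintype.card_fin] at this
    rw [Matrix.sub_apply, Matrix.smul_apply, Matrix.one_apply, eq_sub_iff_add_eq']
    simpa [Matrix.mul_apply] using this

/-- After one involution is transported to the other set, both are permutations of cycle type 2^k
with the same k, since each has a single fixed point; equal cycle types are conjugate. -/
theorem exists_equiv_semiconj {α β : Type*} [Fintype α] [Fintype β]
    {f : α → α} {g : β → β} (hf : Function.Involutive f) (hg : Function.Involutive g) {a : α} {b : β}
    (ha : ∀ x, f x = x ↔ x = a) (hb : ∀ x, g x = x ↔ x = b)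
    (h : Fintype.card α = Fintype.card β) : ∃ σ : α ≃ β, ∀ x, σ (f x) = g (σ x) := by
  classical
  let e : α ≃ β := Fintype.equivOfCardEq h
  let τ : Equiv.Perm α := hf.toPerm
  let ρ : Equiv.Perm α := (e.trans hg.toPerm).trans e.symm
  have key : ∀ (π : Equiv.Perm α) (c : α), π ^ 2 = 1 → (∀ x, π x = x ↔ x = c) →
      π.cycleType = Multiset.replicate ((Fintype.card α - 1) / 2) 2 := by
    intro π c h2 hc
    have : Fact (Nat.Prime 2) := ⟨Nat.prime_two⟩
    obtain ⟨k, hk⟩ : ∃ k, π.cycleType = Multiset.replicate k 2 :=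
      ⟨_, Multiset.eq_replicate_card.2 (Equiv.Perm.pow_prime_eq_one_iff.1 h2)⟩
    have hsupp : π.support = Finset.univ.erase c := by
      ext x
      simp [hc]
    have hsum := π.sum_cycleType
    rw [hk, hsupp, Finset.card_erase_of_mem (Finset.mem_univ _), Finset.card_univ,
      Multiset.sum_replicate, smul_eq_mul] at hsum
    rw [hk, ← hsum, Nat.mul_div_cancel _ two_pos]
  have hconj : IsConj τ ρ := by
    rw [Equiv.Perm.isConj_iff_cycleType_eq, key τ a ?_ ha, key ρ (e.symm b) ?_ ?_]
    · ext x
      simp [sq, ρ, hg _]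
    · intro x
      simp only [ρ, Equiv.trans_apply, Function.Involutive.coe_toPerm, Equiv.symm_apply_eq, hb,
        Equiv.eq_symm_apply]
    · ext x
      simp [sq, τ, hf _]
  obtain ⟨c, hc⟩ := isConj_iff.1 hconj
  refine ⟨c.trans e, fun x => ?_⟩
  have := congrArg e (Equiv.congr_fun hc (c x))
  simpa [τ, ρ] using this

/-! ### Group-developed matrices and inversion -/

section Circulant

variable {G : Type*} [CommGroup G]

/-- The matrix with rows and columns indexed by a group which is developed from a function. -/
def groupMatrix (a : G → ℤ) : Matrix G G ℤ := of fun x y => a (x⁻¹ * y)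

/-- The permutation matrix of the inversion of a group. -/
def inversionMatrix (G : Type*) [CommGroup G] [DecidableEq G] : Matrix G G ℤ :=
  of fun x y => if y = x⁻¹ then 1 else 0

theorem groupMatrix_isSymm {a : G → ℤ} (ha : ∀ g, a g⁻¹ = a g) : (groupMatrix a).IsSymm := by
  ext x y
  simp only [groupMatrix, transpose_apply, of_apply]
  rw [← ha, mul_inv, inv_inv, mul_comm]

theorem inversionMatrix_isSymm [DecidableEq G] : (inversionMatrix G).IsSymm := by
  ext x y
  exact if_congr (eq_comm.trans inv_eq_iff_eq_inv) rfl rfl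

variable [Fintype G]

theorem groupMatrix_commute (a b : G → ℤ) : Commute (groupMatrix a) (groupMatrix b) := by
  ext x y
  simp only [groupMatrix, Matrix.mul_apply, of_apply]
  -- The substitution z ↦ xy/z exchanges the two factors x⁻¹z and z⁻¹y.
  rw [← (Equiv.divLeft (x * y)).sum_comp]
  refine Finset.sum_congr rfl fun z _ => ?_
  have h1 : x⁻¹ * (x * y / z) = z⁻¹ * y := by
    rw [mul_div_assoc, inv_mul_cancel_left, div_eq_inv_mul]
  have h2 : (x * y / z)⁻¹ * y = x⁻¹ * z := by
    rw [inv_div, div_mul_eq_mul_div, mul_comm z, mul_comm x, mul_div_mul_left_eq_div,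
      div_eq_inv_mul]
  rw [mul_comm (b _), Equiv.divLeft_apply, h1, h2]

theorem groupMatrix_sq_add_sq [DecidableEq G] {a b : G → ℤ} (ha1 : a 1 = 0)
    (ha : ∀ g, g ≠ 1 → a g = 1 ∨ a g = -1) (hb : ∀ g, b g = 1 ∨ b g = -1)
    (ha' : ∀ g, a g⁻¹ = a g) (hb' : ∀ g, b g⁻¹ = b g)
    (hab : ∀ k, k ≠ 1 → ∑ g, (a g * a (k⁻¹ * g) + b g * b (k⁻¹ * g)) = 0) :
    groupMatrix a * groupMatrix a + groupMatrix b * groupMatrix b =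
      (2 * (Fintype.card G : ℤ) - 1) • (1 : Matrix G G ℤ) := by
  ext x y
  have hsum : (groupMatrix a * groupMatrix a + groupMatrix b * groupMatrix b) x y =
      ∑ g, (a g * a ((x⁻¹ * y)⁻¹ * g) + b g * b ((x⁻¹ * y)⁻¹ * g)) := by
    simp only [groupMatrix, Matrix.add_apply, Matrix.mul_apply, of_apply]
    rw [← Finset.sum_add_distrib]
    symm
    rw [← Equiv.sum_comp (Equiv.mulLeft x⁻¹)]
    refine Finset.sum_congr rfl fun z _ => ?_
    have : (x⁻¹ * y)⁻¹ * (x⁻¹ * z) = (z⁻¹ * y)⁻¹ := by group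
    simp only [Equiv.coe_mulLeft, this, ha', hb']
  rw [hsum, Matrix.smul_apply, Matrix.one_apply]
  split_ifs with h
  · subst h
    have ha2 : ∀ g, a g * a g = 1 - if g = 1 then 1 else 0 := fun g => by
      split_ifs with hg
      · simp [hg, ha1]
      · rcases ha g hg with h | h <;> simp [h]
    have hb2 : ∀ g, b g * b g = 1 := fun g => by rcases hb g with h | h <;> simp [h]
    simp [ha2, hb2, Finset.sum_add_distrib]
    ring
  · rw [hab _ fun hk => h (inv_mul_eq_one.1 hk), smul_zero]

variable [DecidableEq G]

theorem inversionMatrix_mul_apply (M : Matrix G G ℤ) (x y : G) :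
    (inversionMatrix G * M) x y = M x⁻¹ y := by
  simp [inversionMatrix, Matrix.mul_apply]

theorem inversionMatrix_mul_self : inversionMatrix G * inversionMatrix G = 1 := by
  ext x y
  rw [inversionMatrix_mul_apply]
  simp [inversionMatrix, Matrix.one_apply, eq_comm]

theorem inversionMatrix_commute {a : G → ℤ} (ha : ∀ g, a g⁻¹ = a g) :
    Commute (inversionMatrix G) (groupMatrix a) := by
  ext x y
  rw [inversionMatrix_mul_apply]
  have h : ∀ z, y = z⁻¹ ↔ z = y⁻¹ := fun z => eq_comm.trans inv_eq_iff_eq_inv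
  simp only [groupMatrix, inversionMatrix, Matrix.mul_apply, of_apply, h,
    mul_ite, mul_one, mul_zero, Finset.sum_ite_eq', Finset.mem_univ, if_true]
  rw [← ha, mul_inv, inv_inv]

end Circulant

/-! ### Shifted character sums and the converse criterion for cores -/

theorem sum_quadraticChar_add_mul {F : Type*} [Field F] [Fintype F] [DecidableEq F]
    (hF : ringChar F ≠ 2) (s t : F) :
    ∑ w, quadraticChar F (s + w) * quadraticChar F (w + t) =
      (if s = t then (Fintype.card F : ℤ) else 0) - 1 := by
  split_ifs with h
  · subst h
    have h1 : ∀ w, quadraticChar F (s + w) * quadraticChar F (w + s) =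
        1 - if w = -s then 1 else 0 := fun w => by
      split_ifs with hw
      · simp [hw]
      · have : s + w ≠ 0 := fun h => hw (eq_neg_of_add_eq_zero_right h)
        rw [add_comm w s, ← sq, quadraticChar_sq_one this, sub_zero]
    rw [Finset.sum_congr rfl fun w _ => h1 w]
    simp
  · have hc : s - t ≠ 0 := sub_ne_zero.2 h
    -- This affine change turns the sum for s ≠ t into χ(-1) times the Jacobi sum J(χ, χ) = -χ(-1),
    -- hence into -1.
    have hbij : Function.Bijective fun x : F => (s - t) * x - s :=
      ((Equiv.mulLeft₀ (s - t) hc).trans (Equiv.subRight s)).bijective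
    have h1 := jacobiSum_nontrivial_inv (quadraticChar_ne_one hF)
    rw [(quadraticChar_isQuadratic F).inv, jacobiSum] at h1
    have h2 : quadraticChar F (s - t) ^ 2 = 1 := quadraticChar_sq_one hc
    have h3 : quadraticChar F (-1) ^ 2 = 1 := quadraticChar_sq_one (neg_ne_zero.2 one_ne_zero)
    rw [← hbij.sum_comp]
    have h4 : ∀ x, quadraticChar F (s + ((s - t) * x - s)) * quadraticChar F ((s - t) * x - s + t)
        = quadraticChar F (-1) * (quadraticChar F x * quadraticChar F (1 - x)) := fun x => by
      rw [show s + ((s - t) * x - s) = (s - t) * x by ring,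
        show (s - t) * x - s + t = (-1) * ((s - t) * (1 - x)) by ring, map_mul, map_mul, map_mul]
      linear_combination quadraticChar F (-1) * (quadraticChar F x * quadraticChar F (1 - x)) * h2
    simp_rw [h4, ← Finset.mul_sum, h1]
    linear_combination - h3

theorem isSymmetricConferenceCore_of_isSymm {n : ℕ} {Q : Matrix (Fin n) (Fin n) ℤ} (hs : Q.IsSymm)
    (h0 : ∀ i, Q i i = 0) (h1 : ∀ i j, i ≠ j → Q i j = 1 ∨ Q i j = -1) (hr : ∀ i, ∑ j, Q i j = 0)
    (hQ : Q * Q = (n : ℤ) • (1 : Matrix (Fin n) (Fin n) ℤ) - of fun _ _ => 1) :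
    IsSymmetricConferenceCore Q where
  diag := by rintro (i | i) <;> simp [h0]
  off_diag := by
    rintro (i | i) (j | j) hij
    · exact (hij rfl).elim
    · exact .inl rfl
    · exact .inl rfl
    · exact h1 i j fun h => hij (by rw [h])
  symm := IsSymm.fromBlocks (by simp) rfl hs
  mul_transpose := by
    have hr' : ∀ j, ∑ i, Q i j = 0 := fun j => by
      rw [← hr j]
      exact Finset.sum_congr rfl fun i _ => hs.apply j i
    rw [fromBlocks_transpose, hs.eq, fromBlocks_multiply, hQ]
    ext (i | i) (j | j)
    · simp [Matrix.mul_apply, Matrix.smul_apply]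
    · simp [Matrix.mul_apply, Matrix.smul_apply, hr']
    · simp [Matrix.mul_apply, Matrix.smul_apply, hr]
    · rw [fromBlocks_apply₂₂, Matrix.add_apply, Matrix.sub_apply, Matrix.smul_apply,
        Matrix.smul_apply, Matrix.one_apply, Matrix.one_apply]
      simp [Matrix.mul_apply]

/-! ### Mathon's core of order 45 -/

/-- The label of the line through a point of the affine plane of order three, in the parallel class
attached to a nonzero residue modulo five. -/
def lineLabel (d : Fin 5) (x : Fin 3 × Fin 3) : Fin 3 :=
  -- Entry 0 is a filler: the diagonal block is defined without line labels. The other four entries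
  -- are the four parallel classes.
  ![0, x.2, x.1, x.1 - x.2, x.1 + x.2] d

/-- The sign matrix `I + S`, where `S` is the skew core of order three, as a function of the
difference of the indices, with the sign of the residue `d` modulo five. -/
def signedSkew (d : Fin 5) (t : Fin 3) : ℤ :=
  ![0, 1, -1, -1, 1] d * ![1, 1, -1] t

/-- The block of index `d` of Mathon's core of order 45. -/
def mathonBlock (d : Fin 5) (x y : Fin 3 × Fin 3) : ℤ :=
  if d = 0 then
    -- The diagonal block is a Paley core of order nine, whose graph is the 3×3 rook's graph.
    (if x = y then 0 else if x.1 = y.1 ∨ x.2 = y.2 then 1 else -1)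
  else if d ≤ 2 then signedSkew d (lineLabel d x - lineLabel (-d) y)
  -- Reversing the difference makes the block of -d the transpose of the block of d, although I + S
  -- is not symmetric.
  else signedSkew d (lineLabel (-d) y - lineLabel d x)

theorem mathonBlock_symm : ∀ d x y, mathonBlock (-d) y x = mathonBlock d x y := by
  decide +kernel

theorem mathonBlock_sign :
    ∀ d x y, (d ≠ 0 ∨ x ≠ y) → mathonBlock d x y = 1 ∨ mathonBlock d x y = -1 := by
  decide +kernel

theorem sum_mathonBlock : ∀ x, ∑ k, ∑ z, mathonBlock k x z = 0 := by
  decide +kernel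

/-- This is C² = 45I - J for the block-circulant C, with symmetry used to turn columns into rows; by
circulance only the difference d of block indices has to be tested. -/
theorem sum_mathonBlock_mul : ∀ d x y,
    ∑ k, ∑ z, mathonBlock k x z * mathonBlock (k - d) y z =
      (if d = 0 ∧ x = y then 45 else 0) - 1 := by
  decide +kernel

theorem exists_isSymmetricConferenceCore_45 :
    ∃ Q : Matrix (Fin 45) (Fin 45) ℤ, IsSymmetricConferenceCore Q := by
  let e : Fin 45 ≃ Fin 5 × (Fin 3 × Fin 3) := Fintype.equivOfCardEq (by simp)
  let C : Matrix (Fin 5 × (Fin 3 × Fin 3)) (Fin 5 × (Fin 3 × Fin 3)) ℤ :=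
    of fun i j => mathonBlock (j.1 - i.1) i.2 j.2
  have hC : C.IsSymm := by
    ext i j
    simp only [C, transpose_apply, of_apply]
    rw [← mathonBlock_symm, neg_sub]
  have hr : ∀ i, ∑ j, C i j = 0 := fun i => by
    rw [Fintype.sum_prod_type, ← sum_mathonBlock i.2]
    exact (Equiv.subRight i.1).sum_comp fun k => ∑ z, mathonBlock k i.2 z
  have hCC : C * C = (45 : ℤ) • 1 - of fun _ _ => 1 := by
    ext i j
    have h := sum_mathonBlock_mul (j.1 - i.1) i.2 j.2
    rw [← (Equiv.subRight i.1).sum_comp] at h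
    have hij : (j.1 - i.1 = 0 ∧ i.2 = j.2) ↔ i = j := by
      rw [sub_eq_zero, eq_comm (a := j.1), ← Prod.ext_iff]
    simp only [hij, Equiv.subRight_apply, sub_sub_sub_cancel_right] at h
    rw [Matrix.sub_apply, Matrix.smul_apply, Matrix.one_apply, Matrix.mul_apply,
      Fintype.sum_prod_type]
    simp only [hC.apply j, smul_eq_mul, mul_ite, mul_one, mul_zero, of_apply]
    exact h
  refine ⟨C.submatrix e e, isSymmetricConferenceCore_of_isSymm (hC.submatrix e) (fun i => ?_)
    (fun i j hij => ?_) (fun i => ?_) ?_⟩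
  · simp [C, mathonBlock]
  · refine mathonBlock_sign _ _ _ ?_
    by_contra! h
    exact hij (e.injective (Prod.ext (sub_eq_zero.1 h.1).symm h.2))
  · rw [← hr (e i)]
    exact e.sum_comp fun j => C (e i) j
  · rw [submatrix_mul_equiv, hCC]
    ext i j
    simp only [submatrix_apply, Matrix.sub_apply, Matrix.smul_apply, Matrix.one_apply, of_apply,
      e.injective.eq_iff, Nat.cast_ofNat]

/-! ### Assembly of the theorem -/

/-- Symmetric commuting sign matrices `X, Y, Y, Z` with the additive property yield symmetric
Williamson-type matrices and a symmetric propus-type Hadamard matrix. -/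
theorem exists_williamson_and_propus {κ : Type*} [Fintype κ] [DecidableEq κ] {m : ℕ}
    (hκ : Fintype.card κ = m) {X Y Z : Matrix κ κ ℤ} (hX : X.IsSymm) (hY : Y.IsSymm)
    (hZ : Z.IsSymm) (hX1 : ∀ i j, X i j = 1 ∨ X i j = -1) (hY1 : ∀ i j, Y i j = 1 ∨ Y i j = -1)
    (hZ1 : ∀ i j, Z i j = 1 ∨ Z i j = -1) (hXY : Commute X Y) (hXZ : Commute X Z)
    (hYZ : Commute Y Z) (h : X * X + (2 : ℤ) • (Y * Y) + Z * Z = (4 * (m : ℤ)) • 1) :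
    (∃ W : Fin 4 → Matrix (Fin m) (Fin m) ℤ, IsSymmetricWilliamsonType W) ∧
      ∃ H : Matrix (Fin (4 * m)) (Fin (4 * m)) ℤ, IsSymmetricPropusTypeHadamard H := by
  let e : Fin m ≃ κ := (Fintype.equivFinOfCardEq hκ).symm
  have hcomm : ∀ {M N : Matrix κ κ ℤ}, M.IsSymm → N.IsSymm → Commute M N →
      Amicable (M.submatrix e e) (N.submatrix e e) := fun {M N} hM hN hMN => by
    rw [Amicable, transpose_submatrix, transpose_submatrix, hM.eq, hN.eq, submatrix_mul_equiv,
      submatrix_mul_equiv, hMN.eq]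
  have hsum : X.submatrix e e * X.submatrix e e + (2 : ℤ) • (Y.submatrix e e * Y.submatrix e e) +
      Z.submatrix e e * Z.submatrix e e = (4 * (m : ℤ)) • 1 := by
    rw [submatrix_mul_equiv, submatrix_mul_equiv, submatrix_mul_equiv, ← submatrix_one_equiv e]
    exact congrArg (fun M => M.submatrix e e) h
  have hX' := hX.submatrix e
  have hY' := hY.submatrix e
  have hZ' := hZ.submatrix e
  refine ⟨⟨![X.submatrix e e, Y.submatrix e e, Y.submatrix e e, Z.submatrix e e], ?_, ?_, ?_, ?_⟩,
    _, isSymmetricPropusTypeHadamard_propusArray hX' hY' hZ' ⟨fun i j => hX1 _ _, fun i j => hY1 _ _,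
      fun i j => hZ1 _ _, hX', hcomm hX hY hXY, hcomm hX hZ hXZ, hcomm hY hZ hYZ, ?_⟩⟩
  · intro k i j
    fin_cases k
    exacts [hX1 _ _, hY1 _ _, hY1 _ _, hZ1 _ _]
  · intro k
    fin_cases k
    exacts [hX', hY', hY', hZ']
  · intro k l _
    fin_cases k <;> fin_cases l
    exacts [rfl, hcomm hX hY hXY, hcomm hX hY hXY, hcomm hX hZ hXZ,
      hcomm hY hX hXY.symm, rfl, rfl, hcomm hY hZ hYZ,
      hcomm hY hX hXY.symm, rfl, rfl, hcomm hY hZ hYZ,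
      hcomm hZ hX hXZ.symm, hcomm hZ hY hYZ.symm, hcomm hZ hY hYZ.symm, rfl]
  · simp only [Fin.sum_univ_four, cons_val, hX'.eq, hY'.eq, hZ'.eq]
    rw [← hsum, two_smul]
    abel
  · rw [hX'.eq, hY'.eq, hZ'.eq, hsum]

theorem exists_field_card_eq {q : ℕ} (hq : IsPrimePow q) :
    ∃ (F : Type) (_ : Field F) (_ : Fintype F), Fintype.card F = q := by
  obtain ⟨f⟩ := Fintype.nonempty_field_iff.2
    (by rwa [Fintype.card_fin] : IsPrimePow (Fintype.card (Fin q)))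
  exact ⟨Fin q, f, inferInstance, Fintype.card_fin q⟩

/-- A symmetric matrix with the orthogonality properties of a conference matrix core, whose zeros
are the ones of the inversion matrix of a given group of odd order. -/
theorem exists_inversion_core {G F : Type*} [CommGroup G] [Fintype G] [DecidableEq G]
    [Field F] [Fintype F] (h : Fintype.card G = Fintype.card F) (hodd : Odd (Fintype.card G)) :
    ∃ P : Matrix G G ℤ, P.IsSymm ∧
      (∀ i j, (P i j = 0 ∧ inversionMatrix G i j = 1) ∨
        (inversionMatrix G i j = 0 ∧ (P i j = 1 ∨ P i j = -1))) ∧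
      P * P = (Fintype.card G : ℤ) • (1 : Matrix G G ℤ) - of (fun _ _ => 1) ∧
      ∀ i, ∑ j, P i j = 0 := by
  classical
  have hF : ringChar F ≠ 2 := fun h2 => by
    have := FiniteField.even_card_of_char_two h2
    rw [← h] at this
    exact (Nat.not_odd_iff.2 this) hodd
  have hinv : ∀ x : G, x⁻¹ = x ↔ x = 1 := fun x => by
    refine ⟨fun hx => ?_, by rintro rfl; exact inv_one⟩
    have h2 : x ^ 2 = 1 := by rw [sq, ← inv_eq_iff_mul_eq_one, hx]
    obtain ⟨m, hm⟩ := hodd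
    have := pow_card_eq_one (x := x)
    rwa [hm, pow_succ, pow_mul, h2, one_pow, one_mul] at this
  obtain ⟨σ, hσ⟩ := exists_equiv_semiconj (f := fun x : G => x⁻¹) (g := fun x : F => -x)
    inv_involutive neg_involutive hinv (fun x => Ring.eq_self_iff_eq_zero_of_char_ne_two hF) h
  -- The sum, unlike the difference in Paley's matrix, is symmetric for either residue of |F| mod 4.
  -- Since σ turns inversion into negation, the zeros fall where y = x⁻¹.
  refine ⟨of fun x y => quadraticChar F (σ x + σ y), ?_, fun x y => ?_, ?_, fun x => ?_⟩
  · ext x y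
    simp only [transpose_apply, of_apply, add_comm]
  · simp only [of_apply, inversionMatrix]
    by_cases hxy : y = x⁻¹
    · left
      rw [if_pos hxy, hxy, hσ, add_neg_cancel]
      exact ⟨quadraticChar_zero, rfl⟩
    · right
      rw [if_neg hxy]
      refine ⟨rfl, quadraticChar_dichotomy fun h0 => hxy (σ.injective ?_)⟩
      rw [hσ]
      exact eq_neg_of_add_eq_zero_right h0
  · ext x y
    rw [Matrix.mul_apply, Matrix.sub_apply, Matrix.smul_apply, Matrix.one_apply]
    simp only [of_apply]
    rw [σ.sum_comp fun w => quadraticChar F (σ x + w) * quadraticChar F (w + σ y),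
      sum_quadraticChar_add_mul hF, h]
    simp only [σ.injective.eq_iff, smul_eq_mul, mul_ite, mul_one, mul_zero]
  · simp only [of_apply]
    rw [σ.sum_comp fun w => quadraticChar F (σ x + w), ← quadraticChar_sum_zero hF]
    exact Equiv.sum_comp (Equiv.addLeft (σ x)) fun w => quadraticChar F w

theorem exists_of_core {q : ℕ} (hq : IsPrimePow q) (hq4 : q ≡ 1 [MOD 4])
    (h : IsPrimePow ((q + 1) / 2) ∨
      ∃ Q : Matrix (Fin ((q + 1) / 2)) (Fin ((q + 1) / 2)) ℤ, IsSymmetricConferenceCore Q) :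
    (∃ W : Fin 4 → Matrix (Fin (q + 2)) (Fin (q + 2)) ℤ, IsSymmetricWilliamsonType W) ∧
      ∃ H : Matrix (Fin (4 * (q + 2))) (Fin (4 * (q + 2))) ℤ, IsSymmetricPropusTypeHadamard H := by
  classical
  obtain ⟨F, _, _, rfl⟩ := exists_field_card_eq hq
  obtain ⟨G, _, _, a, b, hG, ha1, ha, hb, ha', hb', hab⟩ := exists_complementary_pair hq4
  have hcard : (Fintype.card F + 1) / 2 = Fintype.card G := by omega
  have hodd : Odd (Fintype.card G) := by
    have h4 : Fintype.card F % 4 = 1 := hq4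
    rw [Nat.odd_iff]
    omega
  have hA0 : ∀ i, groupMatrix a i i = 0 := fun i => by simp [groupMatrix, ha1]
  have hA1 : ∀ i j, i ≠ j → groupMatrix a i j = 1 ∨ groupMatrix a i j = -1 := fun i j hij =>
    ha _ fun h => hij (inv_mul_eq_one.1 h)
  have hsq := groupMatrix_sq_add_sq ha1 ha hb ha' hb' hab
  have hm : Fintype.card (Unit ⊕ (G ⊕ G)) = Fintype.card F + 2 := by
    simp only [Fintype.card_sum, Fintype.card_unit]
    omega
  have hm' : 2 * (Fintype.card G : ℤ) + 1 = ((Fintype.card F + 2 : ℕ) : ℤ) := by omega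
  obtain ⟨P, R, hP, hR, hPR, hRA, hRB, hR2, hP2, hPr⟩ : ∃ P R : Matrix G G ℤ, P.IsSymm ∧ R.IsSymm ∧
      (∀ i j, (P i j = 0 ∧ R i j = 1) ∨ (R i j = 0 ∧ (P i j = 1 ∨ P i j = -1))) ∧
      Commute R (groupMatrix a) ∧ Commute R (groupMatrix b) ∧ R * R = 1 ∧
      P * P = (Fintype.card G : ℤ) • (1 : Matrix G G ℤ) - of (fun _ _ => 1) ∧
      ∀ i, ∑ j, P i j = 0 := by
    rcases h with h | ⟨Q, hQ⟩
    · obtain ⟨F', _, _, hF'⟩ := exists_field_card_eq h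
      obtain ⟨P, hP, hPR, hP2, hPr⟩ := exists_inversion_core (hcard.symm.trans hF'.symm) hodd
      exact ⟨P, inversionMatrix G, hP, inversionMatrix_isSymm, hPR, inversionMatrix_commute ha',
        inversionMatrix_commute hb', inversionMatrix_mul_self, hP2, hPr⟩
    · obtain ⟨hQs, hQ0, hQ1, hQr, hQ2⟩ := hQ.properties
      let e : G ≃ Fin ((Fintype.card F + 1) / 2) := Fintype.equivFinOfCardEq hcard.symm
      refine ⟨Q.submatrix e e, 1, hQs.submatrix e, isSymm_one, fun i j => ?_, Commute.one_left _,
        Commute.one_left _, one_mul 1, ?_, fun i => ?_⟩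
      · rw [submatrix_apply]
        by_cases hij : i = j
        · left
          rw [hij, Matrix.one_apply_eq]
          exact ⟨hQ0 _, rfl⟩
        · right
          exact ⟨Matrix.one_apply_ne hij, hQ1 _ _ fun h => hij (e.injective h)⟩
      · rw [submatrix_mul_equiv, hQ2, ← hcard]
        ext i j
        simp only [submatrix_apply, Matrix.sub_apply, Matrix.smul_apply, Matrix.one_apply, of_apply,
          e.injective.eq_iff]
      · rw [← hQr (e i)]
        exact e.sum_comp fun j => Q (e i) j
  obtain ⟨X, Y, Z, hX, hY, hZ, hX1, hY1, hZ1, hXY, hXZ, hYZ, hsum⟩ :=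
    exists_symm_commuting_quadruple (groupMatrix_isSymm ha') (groupMatrix_isSymm hb') hP hR hA0 hA1
      (fun i j => hb _) hPR (groupMatrix_commute a b) hRA hRB hsq hR2 hP2 hPr
  exact exists_williamson_and_propus hm hX hY hZ hX1 hY1 hZ1 hXY hXZ hYZ (by rw [hsum, hm'])

end Propus

theorem mainTheorem2 :
    (∀ q : ℕ, IsPrimePow q → q ≡ 1 [MOD 4] →
      (IsPrimePow ((q + 1) / 2) ∨
        ∃ Q : Matrix (Fin ((q + 1) / 2)) (Fin ((q + 1) / 2)) ℤ,
          Propus.IsSymmetricConferenceCore Q) →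
      (∃ W : Fin 4 → Matrix (Fin (q + 2)) (Fin (q + 2)) ℤ,
          Propus.IsSymmetricWilliamsonType W) ∧
        ∃ H : Matrix (Fin (4 * (q + 2))) (Fin (4 * (q + 2))) ℤ,
          Propus.IsSymmetricPropusTypeHadamard H) ∧
    (∃ Q : Matrix (Fin 45) (Fin 45) ℤ, Propus.IsSymmetricConferenceCore Q) ∧
    (∃ H : Matrix (Fin (4 * 11)) (Fin (4 * 11)) ℤ, Propus.IsSymmetricPropusTypeHadamard H) ∧
    (∃ H : Matrix (Fin (4 * 83)) (Fin (4 * 83)) ℤ, Propus.IsSymmetricPropusTypeHadamard H) := by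
  refine ⟨fun q hq hq4 h => Propus.exists_of_core hq hq4 h,
    Propus.exists_isSymmetricConferenceCore_45, ?_, ?_⟩
  -- 11 = 9 + 2 with (9+1)/2 = 5 prime; next, 83 = 81 + 2 with (81+1)/2 = 41 prime.
  · exact (Propus.exists_of_core (q := 9) (Nat.prime_three.isPrimePow.pow two_ne_zero) rfl
      (.inl (Nat.prime_five.isPrimePow))).2
  · exact (Propus.exists_of_core (q := 81) (Nat.prime_three.isPrimePow.pow four_ne_zero) rfl
      (.inl (by norm_num : Nat.Prime 41).isPrimePow)).2
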